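/- Write $\mathbb{F}_2$ for the field with two elements. A GF(2)-grammar over the alphabet $\{a,b\}$ consists of a finite set $N$ of nonterminal symbols, an initial symbol $S \in N$, and a finite set of rules $C \to X_1 \cdots X_\ell$ with $C \in N$, $\ell \ge 0$ and $X_1,\dots,X_\ell \in \{a,b\} \cup N$, such that for every $C \in N$ every word $w \in \{a,b\}^*$ has only finitely many parse trees with root $C$ in the ordinary (context-free) grammar with these rules. It describes the language of all words $w$ for which the number of parse trees of $w$ with root $S$ is odd. For a language $L \subseteq a^*b^*$ let $\mathrm{Dual}(L) = \sum_{a^n b^m \in L} a^n b^m \in \mathbb{F}_2[[a,b]]$, where $a$ and $b$ are now commuting variables; $\mathrm{Dual}$ is a bijection from the set of all languages $L \subseteq a^*b^*$ onto $\mathbb{F}_2[[a,b]]$. Let $\mathcal{A} \subseteq \mathbb{F}_2[[a]]$ be the set of all power series in $a$ that are algebraic, that is, that are a root of some nonzero polynomial with coefficients in $\mathbb{F}_2[a]$, and define $\mathcal{B} \subseteq \mathbb{F}_2[[b]]$ similarly. Let $R_{a,b}^{int}$ be the set of all elements of the field of fractions of $\mathbb{F}_2[[a,b]]$ that can be represented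 as $$\frac{\sum_{i=1}^n A_i B_i}{p},$$ where $n \ge 0$, $A_i \in \mathcal{A}$ and $B_i \in \mathcal{B}$ for all $i$ from $1$ to $n$, and $p \in \mathbb{F}_2[a,b]$ is a polynomial with constant term equal to $1$. **Theorem.** If $f \in R_{a,b}^{int}$, then $f \in \mathbb{F}_2[[a,b]]$, and the language $\mathrm{Dual}^{-1}(f) \subseteq a^*b^*$ is described by a GF(2)-grammar over $\{a,b\}$. -/

import Mathlib

noncomputable section

/-! ### GF(2)-grammars -/

mutual

/-- Parse trees of an ordinary (context-free) grammar with a given root symbol: a leaf carries a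
terminal symbol, and an inner node carries a nonterminal symbol `A` together with a rule
`A → α` of the grammar and a sequence of subtrees, one for each symbol of `α`, in order. -/
inductive ParseTree {T : Type} (G : ContextFreeGrammar T) : Symbol T G.NT → Type
  | leaf (t : T) : ParseTree G (.terminal t)
  | node (A : G.NT) (α : List (Symbol T G.NT)) (h : ContextFreeRule.mk A α ∈ G.rules)
      (children : ParseForest G α) : ParseTree G (.nonterminal A)

/-- Sequences of parse trees whose sequence of root symbols is the given one. -/
inductive ParseForest {T : Type} (G : ContextFreeGrammar T) : List (Symbol T G.NT) → Type
  | nil : ParseForest G []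
  | cons (X : Symbol T G.NT) (α : List (Symbol T G.NT)) (t : ParseTree G X)
      (ts : ParseForest G α) : ParseForest G (X :: α)

end

mutual

/-- The word spelled by the leaves of a parse tree, from left to right. -/
def ParseTree.yield {T : Type} {G : ContextFreeGrammar T} {X : Symbol T G.NT} :
    ParseTree G X → List T
  | .leaf t => [t]
  | .node _ _ _ children => children.yield

/-- The word spelled by the leaves of a sequence of parse trees, from left to right. -/
def ParseForest.yield {T : Type} {G : ContextFreeGrammar T} {α : List (Symbol T G.NT)} :
    ParseForest G α → List T
  | .nil => []
  | .cons _ _ t ts => t.yield ++ ts.yield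

end

/-- The parse trees of the word `w` as the nonterminal `A`. -/
def ParseTreesOf {T : Type} (G : ContextFreeGrammar T) (A : G.NT) (w : List T) : Type :=
  {t : ParseTree G (.nonterminal A) // t.yield = w}

/-- A GF(2)-grammar over the alphabet `T`: syntactically an ordinary grammar (finitely many
nonterminals, finitely many rules), in which every word has only finitely many parse trees as
each nonterminal. -/
structure GF2Grammar (T : Type) extends ContextFreeGrammar T where
  finite_NT : Finite NT
  finite_parseTrees : ∀ (A : NT) (w : List T), Finite (ParseTreesOf toContextFreeGrammar A w)

/-- The language `L_G(A)` of all words with an odd number of parse trees as `A`. -/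
def GF2Grammar.languageOf {T : Type} (G : GF2Grammar T) (A : G.NT) : Language T :=
  {w | Odd (Nat.card (ParseTreesOf G.toContextFreeGrammar A w))}

/-- The language described by a GF(2)-grammar: the language of its initial symbol. -/
def GF2Grammar.language {T : Type} (G : GF2Grammar T) : Language T :=
  G.languageOf G.initial

/-- `L` is described by some GF(2)-grammar over the alphabet `T`. -/
def IsDescribedByGF2Grammar {T : Type} (L : Language T) : Prop :=
  ∃ G : GF2Grammar T, G.language = L

/-! ### Subsets of `a^* b^*` and power series in two variables over the two-element field -/

/-- The alphabet `{a, b}`; its letters also serve as the two variables of power series. -/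
inductive Letter
  | a
  | b
deriving DecidableEq

/-- The word `a^n b^m` for the exponent vector `(n, m)`. -/
def abWord (e : Letter →₀ ℕ) : List Letter :=
  List.replicate (e .a) .a ++ List.replicate (e .b) .b

theorem abWord_injective : Function.Injective abWord := by
  intro e e' h
  have ha := congrArg (List.count Letter.a) h
  have hb := congrArg (List.count Letter.b) h
  simp [abWord, List.count_replicate] at ha hb
  ext x
  cases x
  · exact ha
  · exact hb

/-- The language `a^* b^*`. -/
def aStarBStar : Language Letter :=
  {w | ∃ n m : ℕ, w = List.replicate n .a ++ List.replicate m .b}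

theorem abWord_mem (e : Letter →₀ ℕ) : abWord e ∈ aStarBStar := ⟨e .a, e .b, rfl⟩

theorem exists_abWord {w : List Letter} (hw : w ∈ aStarBStar) : ∃ e, abWord e = w := by
  obtain ⟨n, m, rfl⟩ := hw
  refine ⟨Finsupp.single .a n + Finsupp.single .b m, ?_⟩
  simp [abWord]

open Classical in
/-- The correspondence between the subsets `{a^n b^m | (n, m) ∈ S}` of `a^* b^*` and the power
series `∑_{(n, m) ∈ S} a^n b^m` over the field with two elements. -/
def Dual : {L : Language Letter // L ≤ aStarBStar} ≃ MvPowerSeries Letter (ZMod 2) where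
  toFun L := fun e => if abWord e ∈ L.1 then 1 else 0
  invFun f := ⟨{w | ∃ e, abWord e = w ∧ MvPowerSeries.coeff e f = 1}, by
    rintro _ ⟨e, rfl, -⟩
    exact abWord_mem e⟩
  left_inv L := by
    apply Subtype.ext
    ext w
    constructor
    · rintro ⟨e, rfl, he⟩
      by_contra hn
      have h0 : (if abWord e ∈ L.1 then (1 : ZMod 2) else 0) = 1 := he
      rw [if_neg hn] at h0
      exact absurd h0 (by decide)
    · intro hw
      obtain ⟨e, rfl⟩ := exists_abWord (L.2 hw)
      exact ⟨e, rfl, if_pos hw⟩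
  right_inv f := by
    funext e
    have key : (∃ e', abWord e' = abWord e ∧ MvPowerSeries.coeff e' f = 1) ↔ f e = 1 := by
      constructor
      · rintro ⟨e', h, h1⟩
        rw [abWord_injective h] at h1
        exact h1
      · intro h
        exact ⟨e, rfl, h⟩
    change (if (∃ e', abWord e' = abWord e ∧ MvPowerSeries.coeff e' f = 1) then (1 : ZMod 2)
      else 0) = f e
    simp only [key]
    generalize f e = c
    revert c
    decide

/-- Laurent series in `a` and `b`: fractions of formal power series. -/
abbrev ABLaurentSeries : Type := FractionRing (MvPowerSeries Letter (ZMod 2))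

/-- The algebraic power series in the single variable `x`, as a set of power series in `a` and
`b`: these are the series `g(x)`, where the one-variable power series `g` is a root of a nonzero
polynomial with coefficients in the ring of one-variable polynomials. -/
def algebraicSeries (x : Letter) : Set (MvPowerSeries Letter (ZMod 2)) :=
  {f | ∃ g : PowerSeries (ZMod 2), IsAlgebraic (Polynomial (ZMod 2)) g ∧
    f = PowerSeries.subst (MvPowerSeries.X x : MvPowerSeries Letter (ZMod 2)) g}

/-- The set `R_{a,b}^{int}` of the Laurent series `(∑_{i=1}^n A_i B_i) / p`, where `A_i` and `B_i`
are algebraic power series in `a` and in `b` respectively, and `p` is a polynomial in `a` and `b`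
with constant term `1`. -/
def Rint : Set ABLaurentSeries :=
  {f | ∃ (n : ℕ) (A B : Fin n → MvPowerSeries Letter (ZMod 2)) (p : MvPolynomial Letter (ZMod 2)),
    (∀ i, A i ∈ algebraicSeries .a) ∧ (∀ i, B i ∈ algebraicSeries .b) ∧
    MvPolynomial.constantCoeff p = 1 ∧
    f = algebraMap (MvPowerSeries Letter (ZMod 2)) ABLaurentSeries (∑ i, A i * B i) /
      algebraMap (MvPowerSeries Letter (ZMod 2)) ABLaurentSeries
        (p : MvPowerSeries Letter (ZMod 2))}

end

/-! ### Convolution of weighted languages -/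

section Convolution

variable {T : Type} {R : Type*} [CommSemiring R]

/-- The ways of splitting a word into a prefix and a suffix. -/
def wordSplits (w : List T) : Set (List T × List T) := {p | p.1 ++ p.2 = w}

theorem wordSplits_finite (w : List T) : (wordSplits w).Finite := by
  refine ((Set.finite_Iic w.length).image fun k => (w.take k, w.drop k)).subset ?_
  rintro ⟨u, v⟩ rfl
  exact ⟨u.length, by simp, by simp⟩

/-- The ways of splitting a word into a prefix and a suffix, as a finite set. -/
noncomputable def wordAntidiagonal (w : List T) : Finset (List T × List T) :=
  (wordSplits_finite w).toFinset

@[simp]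
theorem mem_wordAntidiagonal {w : List T} {p : List T × List T} :
    p ∈ wordAntidiagonal w ↔ p.1 ++ p.2 = w := by
  simp [wordAntidiagonal, wordSplits]

/-- The concatenation product of weighted languages. -/
noncomputable def wordConv (f g : List T → R) : List T → R := fun w =>
  ∑ p ∈ wordAntidiagonal w, f p.1 * g p.2

variable {N : Type}

open Classical in
/-- The weighted language of a symbol, given those of the nonterminals. -/
noncomputable def symbolLanguage (F : N → List T → R) : Symbol T N → List T → R
  | .terminal t => fun w => if w = [t] then 1 else 0
  | .nonterminal A => F A

open Classical in
/-- The weighted language of a string of symbols, given those of the nonterminals. -/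
noncomputable def stringLanguage (F : N → List T → R) : List (Symbol T N) → List T → R
  | [] => fun w => if w = [] then 1 else 0
  | X :: α => wordConv (symbolLanguage F X) (stringLanguage F α)

end Convolution

/-! ### Counting parse trees -/

section Counting

variable {T : Type} {G : ContextFreeGrammar T}

/-- The parse trees of the word `w` as the symbol `X`. -/
def SymbolTreesOf (G : ContextFreeGrammar T) (X : Symbol T G.NT) (w : List T) : Type :=
  {t : ParseTree G X // t.yield = w}

/-- The sequences of parse trees of the word `w` as the string `α`. -/
def ForestsOf (G : ContextFreeGrammar T) (α : List (Symbol T G.NT)) (w : List T) : Type :=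
  {t : ParseForest G α // t.yield = w}

theorem card_symbolTreesOf_terminal (t : T) (w : List T) [Decidable (w = [t])] :
    Nat.card (SymbolTreesOf G (.terminal t) w) = if w = [t] then 1 else 0 := by
  split_ifs with h
  · rw [Nat.card_eq_one_iff_unique]
    refine ⟨⟨?_⟩, ⟨⟨.leaf t, by simp [ParseTree.yield, h]⟩⟩⟩
    rintro ⟨⟨⟩, _⟩ ⟨⟨⟩, _⟩
    rfl
  · rw [Nat.card_eq_zero]
    left
    refine ⟨?_⟩
    rintro ⟨⟨⟩, h'⟩
    exact h (by simpa [ParseTree.yield] using h'.symm)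

theorem card_forestsOf_nil (w : List T) [Decidable (w = [])] :
    Nat.card (ForestsOf G [] w) = if w = [] then 1 else 0 := by
  split_ifs with h
  · rw [Nat.card_eq_one_iff_unique]
    refine ⟨⟨?_⟩, ⟨⟨.nil, by simp [ParseForest.yield, h]⟩⟩⟩
    rintro ⟨⟨⟩, _⟩ ⟨⟨⟩, _⟩
    rfl
  · rw [Nat.card_eq_zero]
    left
    refine ⟨?_⟩
    rintro ⟨⟨⟩, h'⟩
    exact h (by simpa [ParseForest.yield] using h'.symm)

/-- A sequence of parse trees splits into its first tree and the others. -/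
def forestsOfConsEquiv (X : Symbol T G.NT) (α : List (Symbol T G.NT)) (w : List T) :
    ForestsOf G (X :: α) w ≃
      Σ p : {p // p ∈ wordAntidiagonal w}, SymbolTreesOf G X p.1.1 × ForestsOf G α p.1.2 where
  toFun
    | ⟨.cons _ _ t ts, h⟩ => ⟨⟨(t.yield, ts.yield), mem_wordAntidiagonal.2 h⟩, ⟨t, rfl⟩, ⟨ts, rfl⟩⟩
  invFun q := ⟨.cons X α q.2.1.1 q.2.2.1, by
    obtain ⟨⟨p, hp⟩, ⟨t, ht⟩, ⟨ts, hts⟩⟩ := q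
    simpa [ParseForest.yield, ht, hts] using hp⟩
  left_inv := by
    rintro ⟨⟨⟩, h⟩
    rfl
  right_inv := by
    rintro ⟨⟨⟨p₁, p₂⟩, hp⟩, ⟨t, ht⟩, ⟨ts, hts⟩⟩
    dsimp only at ht hts
    subst ht hts
    rfl

/-- A parse tree splits into the rule used at the root and the subtrees. -/
def parseTreesOfEquiv (A : G.NT) (w : List T) :
    ParseTreesOf G A w ≃
      Σ α : {α // ContextFreeRule.mk A α ∈ G.rules}, ForestsOf G α.1 w where
  toFun
    | ⟨.node _ α h ts, hw⟩ => ⟨⟨α, h⟩, ⟨ts, hw⟩⟩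
  invFun q := ⟨.node A q.1.1 q.1.2 q.2.1, q.2.2⟩
  left_inv := by
    rintro ⟨⟨⟩, h⟩
    rfl
  right_inv := by
    rintro ⟨⟨α, h⟩, ⟨ts, hts⟩⟩
    rfl

theorem finite_rules_of (A : G.NT) : Finite {α // ContextFreeRule.mk A α ∈ G.rules} :=
  Finite.of_injective (β := {r // r ∈ G.rules}) (fun α => ⟨⟨A, α.1⟩, α.2⟩) fun α β h => by
    simpa [Subtype.ext_iff] using h

mutual

/-- The number of inner nodes of a parse tree. -/
def ParseTree.nodes {X : Symbol T G.NT} : ParseTree G X → ℕ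
  | .leaf _ => 0
  | .node _ _ _ children => children.nodes + 1

/-- The number of inner nodes of a sequence of parse trees. -/
def ParseForest.nodes {α : List (Symbol T G.NT)} : ParseForest G α → ℕ
  | .nil => 0
  | .cons _ _ t ts => t.nodes + ts.nodes

end

theorem finite_forests_of_finite_trees {n : ℕ}
    (h : ∀ X, Finite {t : ParseTree G X // t.nodes ≤ n}) (α : List (Symbol T G.NT)) :
    Finite {ts : ParseForest G α // ts.nodes ≤ n} := by
  induction α with
  | nil =>
    refine @Finite.of_subsingleton _ ⟨?_⟩
    rintro ⟨⟨⟩, _⟩ ⟨⟨⟩, _⟩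
    rfl
  | cons X α ih =>
    have := h X
    let φ : {ts : ParseForest G (X :: α) // ts.nodes ≤ n} →
        {t : ParseTree G X // t.nodes ≤ n} × {ts : ParseForest G α // ts.nodes ≤ n}
      | ⟨.cons _ _ t ts, hn⟩ => (⟨t, le_trans (Nat.le_add_right _ _) hn⟩,
          ⟨ts, le_trans (Nat.le_add_left _ _) hn⟩)
    refine Finite.of_injective φ ?_
    rintro ⟨⟨⟩, _⟩ ⟨⟨⟩, _⟩ heq
    simp only [φ, Prod.mk.injEq, Subtype.mk.injEq] at heq
    obtain ⟨rfl, rfl⟩ := heq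
    rfl

theorem finite_trees_terminal (t : T) : Finite (ParseTree G (.terminal t)) := by
  refine @Finite.of_subsingleton _ ⟨?_⟩
  rintro ⟨⟩ ⟨⟩
  rfl

theorem finite_trees_of_nodes_le (n : ℕ) (X : Symbol T G.NT) :
    Finite {t : ParseTree G X // t.nodes ≤ n} := by
  induction n generalizing X with
  | zero =>
    cases X with
    | terminal t =>
      have := finite_trees_terminal (G := G) t
      infer_instance
    | nonterminal A =>
      refine @Finite.of_subsingleton _ ⟨?_⟩
      rintro ⟨⟨⟩, h⟩
      simp [ParseTree.nodes] at h
  | succ n ih =>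
    cases X with
    | terminal t =>
      have := finite_trees_terminal (G := G) t
      infer_instance
    | nonterminal A =>
      have h₁ := finite_rules_of A
      have h₂ := finite_forests_of_finite_trees ih
      let φ : {t : ParseTree G (.nonterminal A) // t.nodes ≤ n + 1} →
          Σ α : {α // ContextFreeRule.mk A α ∈ G.rules},
            {ts : ParseForest G α.1 // ts.nodes ≤ n}
        | ⟨.node _ α h ts, hn⟩ => ⟨⟨α, h⟩, ⟨ts, Nat.le_of_succ_le_succ hn⟩⟩
      refine Finite.of_injective φ ?_
      rintro ⟨⟨_, α, h, ts⟩, _⟩ ⟨⟨_, α', h', ts'⟩, _⟩ heq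
      simp only [φ, Sigma.mk.injEq, Subtype.mk.injEq] at heq
      obtain ⟨rfl, heq⟩ := heq
      simp only [heq_eq_eq, Subtype.mk.injEq] at heq
      subst heq
      rfl

end Counting

/-! ### Grammars in which the size of a parse tree is bounded linearly in the length of its word -/

section Weights

variable {T N : Type}

/-- The extension of a weight function from nonterminals to symbols, where terminals have weight
`-C`. -/
def symbolWeight (C : ℕ) (wt : N → ℤ) : Symbol T N → ℤ
  | .terminal _ => -C
  | .nonterminal A => wt A

/-- The total weight of a string of symbols. -/
def stringWeight (C : ℕ) (wt : N → ℤ) (α : List (Symbol T N)) : ℤ :=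
  (α.map (symbolWeight C wt)).sum

section Finiteness

variable {G : ContextFreeGrammar T} {C : ℕ} {wt : G.NT → ℤ}

mutual

theorem ParseTree.nodes_le
    (hG : ∀ A α, ContextFreeRule.mk A α ∈ G.rules → 1 + stringWeight C wt α ≤ wt A)
    {X : Symbol T G.NT} (t : ParseTree G X) :
    (t.nodes : ℤ) ≤ C * t.yield.length + symbolWeight C wt X := by
  match t with
  | .leaf _ => simp [ParseTree.nodes, ParseTree.yield, symbolWeight]
  | .node A α h ts =>
    have := ParseForest.nodes_le hG ts
    have := hG A α h
    simp only [ParseTree.nodes, ParseTree.yield, symbolWeight]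
    push_cast
    linarith

theorem ParseForest.nodes_le
    (hG : ∀ A α, ContextFreeRule.mk A α ∈ G.rules → 1 + stringWeight C wt α ≤ wt A)
    {α : List (Symbol T G.NT)} (ts : ParseForest G α) :
    (ts.nodes : ℤ) ≤ C * ts.yield.length + stringWeight C wt α := by
  match ts with
  | .nil => simp [ParseForest.nodes, ParseForest.yield, stringWeight]
  | .cons X α t ts =>
    have h₁ := ParseTree.nodes_le hG t
    have h₂ := ParseForest.nodes_le hG ts
    simp only [stringWeight] at h₂
    simp only [ParseForest.nodes, ParseForest.yield, stringWeight, List.map_cons, List.sum_cons,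
      List.length_append]
    push_cast
    linarith

end

theorem finite_symbolTreesOf
    (hG : ∀ A α, ContextFreeRule.mk A α ∈ G.rules → 1 + stringWeight C wt α ≤ wt A)
    (X : Symbol T G.NT) (w : List T) : Finite (SymbolTreesOf G X w) := by
  let n := (C * w.length + symbolWeight C wt X).toNat
  have := finite_trees_of_nodes_le (G := G) n X
  refine Finite.of_injective (β := {t : ParseTree G X // t.nodes ≤ n}) (fun t => ⟨t.1, ?_⟩) ?_
  · have := ParseTree.nodes_le hG t.1
    rw [t.2] at this
    omega
  · intro s t h
    exact Subtype.ext (Subtype.mk.inj h)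

end Finiteness

variable {R : Type*} [CommSemiring R] {C : ℕ} {wt : N → ℤ}

theorem symbolLanguage_eq_zero {F : N → List T → R}
    (hF : ∀ A (w : List T), C * w.length + wt A < 0 → F A w = 0)
    (X : Symbol T N) (w : List T) (h : C * w.length + symbolWeight C wt X < 0) :
    symbolLanguage F X w = 0 := by
  cases X with
  | nonterminal A => exact hF A w h
  | terminal t =>
    refine if_neg ?_
    rintro rfl
    simp [symbolWeight] at h

theorem stringLanguage_eq_zero {F : N → List T → R}
    (hF : ∀ A (w : List T), C * w.length + wt A < 0 → F A w = 0)
    (α : List (Symbol T N)) (w : List T) (h : C * w.length + stringWeight C wt α < 0) :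
    stringLanguage F α w = 0 := by
  induction α generalizing w with
  | nil =>
    refine if_neg ?_
    rintro rfl
    simp [stringWeight] at h
  | cons X α ih =>
    refine Finset.sum_eq_zero fun p hp => ?_
    rw [mem_wordAntidiagonal] at hp
    subst hp
    simp only [stringWeight, List.map_cons, List.sum_cons, List.length_append] at h ih
    push_cast at h
    by_cases hX : C * (p.1.length : ℤ) + symbolWeight C wt X < 0
    · rw [symbolLanguage_eq_zero hF X _ hX, zero_mul]
    · rw [ih p.2 (by linarith), mul_zero]

theorem stringLanguage_congr {F F' : N → List T → R} {m : ℤ}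
    (hF : ∀ A (w : List T), C * w.length + wt A < 0 → F A w = 0)
    (hF' : ∀ A (w : List T), C * w.length + wt A < 0 → F' A w = 0)
    (h : ∀ A (w : List T), C * w.length + wt A ≤ m → F A w = F' A w)
    (α : List (Symbol T N)) (w : List T) (hw : C * w.length + stringWeight C wt α ≤ m) :
    stringLanguage F α w = stringLanguage F' α w := by
  induction α generalizing w with
  | nil => rfl
  | cons X α ih =>
    refine Finset.sum_congr rfl fun p hp => ?_
    rw [mem_wordAntidiagonal] at hp
    subst hp
    simp only [stringWeight, List.map_cons, List.sum_cons, List.length_append] at hw ih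
    push_cast at hw
    by_cases hX : C * (p.1.length : ℤ) + symbolWeight C wt X < 0
    · rw [symbolLanguage_eq_zero hF X _ hX, symbolLanguage_eq_zero hF' X _ hX, zero_mul, zero_mul]
    by_cases hα : C * (p.2.length : ℤ) + stringWeight C wt α < 0
    · rw [stringLanguage_eq_zero hF α _ hα, stringLanguage_eq_zero hF' α _ hα, mul_zero, mul_zero]
    simp only [stringWeight] at hα
    rw [ih p.2 (by linarith)]
    congr 1
    cases X with
    | terminal t => rfl
    | nonterminal A =>
      simp only [symbolWeight] at hw
      exact h A _ (by linarith)

/-- A system of equations with decreasing weights has at most one solution that vanishes where the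
weight is negative. -/
theorem eq_of_solutions {F F' : N → List T → R} (rhs : N → List (Symbol T N) →₀ R)
    (hrhs : ∀ A, ∀ α ∈ (rhs A).support, 1 + stringWeight C wt α ≤ wt A)
    (hF : ∀ A (w : List T), C * w.length + wt A < 0 → F A w = 0)
    (hF' : ∀ A (w : List T), C * w.length + wt A < 0 → F' A w = 0)
    (h : ∀ A, F A = Finsupp.linearCombination R (stringLanguage F) (rhs A))
    (h' : ∀ A, F' A = Finsupp.linearCombination R (stringLanguage F') (rhs A)) : F = F' := by
  suffices ∀ n : ℕ, ∀ A (w : List T), C * w.length + wt A < n → F A w = F' A w by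
    funext A w
    exact this (C * w.length + wt A + 1).toNat A w (by omega)
  intro n
  induction n with
  | zero =>
    intro A w hw
    rw [hF A w (by simpa using hw), hF' A w (by simpa using hw)]
  | succ n ih =>
    intro A w hw
    rw [h A, h' A, Finsupp.linearCombination_apply, Finsupp.linearCombination_apply,
      Finsupp.sum, Finsupp.sum, Finset.sum_apply, Finset.sum_apply]
    refine Finset.sum_congr rfl fun α hα => ?_
    have := hrhs A α hα
    push_cast at hw
    simp only [Pi.smul_apply]
    rw [stringLanguage_congr (m := n - 1) hF hF' (fun B v hv => ih B v (by linarith)) α w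
      (by linarith)]

end Weights

/-! ### From systems of equations to GF(2)-grammars -/

section Systems

variable {T : Type} {G : ContextFreeGrammar T} {C : ℕ} {wt : G.NT → ℤ}

theorem card_forestsOf
    (hG : ∀ A α, ContextFreeRule.mk A α ∈ G.rules → 1 + stringWeight C wt α ≤ wt A)
    (α : List (Symbol T G.NT)) (w : List T) :
    (Nat.card (ForestsOf G α w) : ZMod 2) =
      stringLanguage (fun A v => (Nat.card (ParseTreesOf G A v) : ZMod 2)) α w ∧
        Finite (ForestsOf G α w) := by
  have hfin := finite_symbolTreesOf hG
  classical
  induction α generalizing w with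
  | nil =>
    constructor
    · rw [card_forestsOf_nil, stringLanguage]
      split_ifs <;> simp_all
    · refine @Finite.of_subsingleton _ ⟨?_⟩
      rintro ⟨⟨⟩, _⟩ ⟨⟨⟩, _⟩
      rfl
  | cons X α ih =>
    have hα := fun v => (ih v).2
    constructor
    · rw [Nat.card_congr (forestsOfConsEquiv X α w), Nat.card_sigma,
        Nat.cast_sum, stringLanguage, wordConv]
      refine Eq.trans ?_ (Finset.sum_coe_sort (wordAntidiagonal w) _)
      refine Finset.sum_congr rfl fun p _ => ?_
      rw [Nat.card_prod, Nat.cast_mul, (ih _).1]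
      congr 1
      cases X with
      | nonterminal A => rfl
      | terminal t =>
        rw [card_symbolTreesOf_terminal, symbolLanguage]
        split_ifs <;> simp_all
    · exact Finite.of_equiv _ (forestsOfConsEquiv X α w).symm

theorem card_parseTreesOf
    (hG : ∀ A α, ContextFreeRule.mk A α ∈ G.rules → 1 + stringWeight C wt α ≤ wt A)
    (rhs : G.NT → List (Symbol T G.NT) →₀ ZMod 2)
    (hrhs : ∀ A α, ContextFreeRule.mk A α ∈ G.rules ↔ α ∈ (rhs A).support) (A : G.NT) :
    (fun w => (Nat.card (ParseTreesOf G A w) : ZMod 2)) =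
      Finsupp.linearCombination (ZMod 2) (stringLanguage fun A w =>
        (Nat.card (ParseTreesOf G A w) : ZMod 2)) (rhs A) := by
  funext w
  have := finite_rules_of A
  have hfor := card_forestsOf hG
  have hfin := fun (α : {α // ContextFreeRule.mk A α ∈ G.rules}) => (hfor α.1 w).2
  have := Fintype.ofFinite {α // ContextFreeRule.mk A α ∈ G.rules}
  rw [Nat.card_congr (parseTreesOfEquiv A w), Nat.card_sigma,
    Nat.cast_sum, Finsupp.linearCombination_apply, Finsupp.sum, Finset.sum_apply]
  refine Eq.trans ?_ (Finset.sum_coe_sort (rhs A).support _)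
  refine Fintype.sum_equiv (Equiv.subtypeEquivRight (hrhs A)) _ _ ?_
  rintro ⟨α, hα⟩
  have h1 : rhs A α = 1 :=
    Fin.eq_one_of_ne_zero _ (Finsupp.mem_support_iff.1 ((hrhs A α).1 hα))
  simp only [Equiv.subtypeEquivRight_apply_coe, Pi.smul_apply, h1, one_smul]
  exact (hfor α w).1

theorem isDescribedByGF2Grammar_of_rules [Finite G.NT]
    (hG : ∀ A α, ContextFreeRule.mk A α ∈ G.rules → 1 + stringWeight C wt α ≤ wt A)
    (rhs : G.NT → List (Symbol T G.NT) →₀ ZMod 2)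
    (hrhs : ∀ A α, ContextFreeRule.mk A α ∈ G.rules ↔ α ∈ (rhs A).support)
    (F : G.NT → List T → ZMod 2)
    (hF₀ : ∀ A (w : List T), C * w.length + wt A < 0 → F A w = 0)
    (hF : ∀ A, F A = Finsupp.linearCombination (ZMod 2) (stringLanguage F) (rhs A)) :
    IsDescribedByGF2Grammar ({w | F G.initial w = 1} : Language T) := by
  refine ⟨⟨G, inferInstance, fun A w => finite_symbolTreesOf hG (.nonterminal A) w⟩, ?_⟩
  ext w
  change Odd (Nat.card (ParseTreesOf G G.initial w)) ↔ F G.initial w = 1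
  rw [← ZMod.natCast_eq_one_iff_odd, eq_of_solutions rhs
    (fun A α h => hG A α ((hrhs A α).2 h)) hF₀
    (F' := fun A w => (Nat.card (ParseTreesOf G A w) : ZMod 2)) ?_ hF
    (card_parseTreesOf hG rhs hrhs)]
  intro A w hw
  have : IsEmpty (ParseTreesOf G A w) := by
    refine ⟨fun t => ?_⟩
    have := ParseTree.nodes_le hG t.1
    rw [t.2] at this
    simp only [symbolWeight] at this
    omega
  simp

/-- A solution of a finite system of equations with decreasing weights is described by a
GF(2)-grammar. -/
theorem isDescribedByGF2Grammar_of_solution {N : Type} [Finite N] (S : N)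
    {C : ℕ} {wt : N → ℤ} (rhs : N → List (Symbol T N) →₀ ZMod 2)
    (hrhs : ∀ A, ∀ α ∈ (rhs A).support, 1 + stringWeight C wt α ≤ wt A)
    (F : N → List T → ZMod 2)
    (hF₀ : ∀ A (w : List T), C * w.length + wt A < 0 → F A w = 0)
    (hF : ∀ A, F A = Finsupp.linearCombination (ZMod 2) (stringLanguage F) (rhs A)) :
    IsDescribedByGF2Grammar ({w | F S w = 1} : Language T) := by
  classical
  have := Fintype.ofFinite N
  let rules : Finset (ContextFreeRule T N) :=
    Finset.univ.biUnion fun A => (rhs A).support.image fun α => ⟨A, α⟩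
  have hrules : ∀ A α, ContextFreeRule.mk A α ∈ rules ↔ α ∈ (rhs A).support := by
    intro A α
    simp only [rules, Finset.mem_biUnion, Finset.mem_univ, true_and, Finset.mem_image,
      ContextFreeRule.mk.injEq]
    constructor
    · rintro ⟨B, β, h, rfl, rfl⟩
      exact h
    · intro h
      exact ⟨A, α, h, rfl, rfl⟩
  exact isDescribedByGF2Grammar_of_rules (G := ⟨N, S, rules⟩)
    (fun A α h => hrhs A α ((hrules A α).1 h)) rhs hrules F hF₀ hF

end Systems

/-! ### Algebraic power series over the two-element field -/

section Squares

open scoped PowerSeries Polynomial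

theorem PowerSeries.coeff_sq_zmod_two (f : (ZMod 2)⟦X⟧) (n : ℕ) :
    coeff n (f ^ 2) = if 2 ∣ n then coeff (n / 2) f else 0 := by
  have h : f.expand 2 two_ne_zero = f ^ 2 := by
    have := MvPowerSeries.map_frobenius_expand 2 two_ne_zero (f := f)
    rw [ZMod.frobenius_zmod] at this
    exact this
  rw [← h, coeff_expand]

theorem PowerSeries.exists_eq_sq_add_X_mul_sq (f : (ZMod 2)⟦X⟧) :
    ∃ u v : (ZMod 2)⟦X⟧, f = u ^ 2 + X * v ^ 2 := by
  refine ⟨mk fun n => coeff (2 * n) f, mk fun n => coeff (2 * n + 1) f, ?_⟩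
  ext n
  rw [map_add]
  rcases n with _ | n
  · simp [coeff_sq_zmod_two, coeff_zero_X_mul]
  · rw [coeff_succ_X_mul, coeff_sq_zmod_two, coeff_sq_zmod_two, coeff_mk, coeff_mk]
    split_ifs with h₁ h₂ h₂
    · omega
    · rw [add_zero, Nat.mul_div_cancel' h₁]
    · rw [zero_add, Nat.mul_div_cancel' h₂]
    · omega

theorem PowerSeries.eq_zero_of_sq_add_X_mul_sq {u v : (ZMod 2)⟦X⟧} (h : u ^ 2 + X * v ^ 2 = 0) :
    u = 0 ∧ v = 0 := by
  constructor
  · ext n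
    have := congrArg (coeff (2 * n)) h
    rw [map_add, coeff_sq_zmod_two] at this
    rcases n with _ | n
    · simpa [coeff_zero_X_mul] using this
    · rw [show 2 * (n + 1) = 2 * n + 1 + 1 by ring, coeff_succ_X_mul, coeff_sq_zmod_two,
        if_pos (by omega), if_neg (by omega), add_zero,
        show (2 * n + 1 + 1) / 2 = n + 1 by omega] at this
      simpa using this
  · ext n
    have := congrArg (coeff (2 * n + 1)) h
    rw [map_add, coeff_sq_zmod_two, coeff_succ_X_mul, coeff_sq_zmod_two,
      if_neg (by omega), if_pos (by omega), zero_add,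
      show 2 * n / 2 = n by omega] at this
    simpa using this

theorem Polynomial.exists_eq_sq_add_X_mul_sq (f : (ZMod 2)[X]) :
    ∃ u v : (ZMod 2)[X], f = u ^ 2 + X * v ^ 2 ∧ 2 * u.natDegree ≤ f.natDegree ∧
      2 * v.natDegree ≤ f.natDegree := by
  have hdeg (p : (ZMod 2)[X]) : 2 * (contract 2 p).natDegree ≤ p.natDegree := by
    by_cases h : contract 2 p = 0
    · simp [h]
    · rw [mul_comm]
      refine le_natDegree_of_ne_zero ?_
      rw [← coeff_contract two_ne_zero]
      exact leadingCoeff_ne_zero.2 h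
  refine ⟨contract 2 f, contract 2 (divX f), ?_, hdeg f,
    (hdeg _).trans (natDegree_divX_le)⟩
  rw [← ZMod.expand_card, ← ZMod.expand_card]
  ext n
  rw [coeff_add]
  rcases n with _ | n
  · simp [coeff_expand, coeff_contract]
  · rw [coeff_X_mul, coeff_expand two_pos, coeff_expand two_pos, coeff_contract two_ne_zero,
      coeff_contract two_ne_zero, coeff_divX]
    split_ifs with h₁ h₂ h₂
    · omega
    · rw [add_zero, Nat.div_mul_cancel h₁]
    · rw [zero_add, Nat.div_mul_cancel h₂]
    · omega

theorem Polynomial.finite_natDegree_le (R : Type*) [Semiring R] [Finite R] (D : ℕ) :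
    {p : R[X] | p.natDegree ≤ D}.Finite := by
  refine Set.Finite.of_finite_image (f := fun p (i : Fin (D + 1)) => p.coeff i) (Set.toFinite _) ?_
  intro p hp q hq h
  ext n
  by_cases hn : n < D + 1
  · exact congrFun h ⟨n, hn⟩
  · rw [Set.mem_ofPred_eq] at hp hq
    rw [coeff_eq_zero_of_natDegree_lt (by omega), coeff_eq_zero_of_natDegree_lt (by omega)]

end Squares

section Christol

open scoped PowerSeries Polynomial

/-- Fractions of power series in one variable over the two-element field. -/
abbrev PowerSeriesFractions : Type := FractionRing (ZMod 2)⟦X⟧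

instance : CharP PowerSeriesFractions 2 :=
  charP_of_injective_algebraMap (algebraMap (ZMod 2) PowerSeriesFractions).injective 2

theorem algebraMap_polynomial_injective :
    Function.Injective (algebraMap (ZMod 2)[X] PowerSeriesFractions) := by
  rw [IsScalarTower.algebraMap_eq (ZMod 2)[X] (ZMod 2)⟦X⟧ PowerSeriesFractions]
  refine (IsFractionRing.injective (ZMod 2)⟦X⟧ PowerSeriesFractions).comp ?_
  intro p q h
  simpa [PowerSeries.algebraMap_apply'] using h

instance : FaithfulSMul (ZMod 2)[X] PowerSeriesFractions :=
  (faithfulSMul_iff_algebraMap_injective _ _).2 algebraMap_polynomial_injective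

theorem algebraMap_polynomial_X :
    algebraMap (ZMod 2)[X] PowerSeriesFractions Polynomial.X =
      algebraMap (ZMod 2)⟦X⟧ PowerSeriesFractions PowerSeries.X := by
  rw [IsScalarTower.algebraMap_apply (ZMod 2)[X] (ZMod 2)⟦X⟧ PowerSeriesFractions,
    PowerSeries.algebraMap_apply']
  simp

theorem eq_zero_of_sq_add_X_mul_sq {u v : PowerSeriesFractions}
    (h : u ^ 2 + algebraMap (ZMod 2)[X] PowerSeriesFractions Polynomial.X * v ^ 2 = 0) :
    u = 0 ∧ v = 0 := by
  obtain ⟨p, q, hq, rfl⟩ := IsFractionRing.div_surjective (A := (ZMod 2)⟦X⟧) u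
  obtain ⟨r, s, hs, rfl⟩ := IsFractionRing.div_surjective (A := (ZMod 2)⟦X⟧) v
  have hq₀ := nonZeroDivisors.ne_zero hq
  have hs₀ := nonZeroDivisors.ne_zero hs
  have hq' : algebraMap (ZMod 2)⟦X⟧ PowerSeriesFractions q ≠ 0 := by simpa using hq₀
  have hs' : algebraMap (ZMod 2)⟦X⟧ PowerSeriesFractions s ≠ 0 := by simpa using hs₀
  rw [algebraMap_polynomial_X] at h
  field_simp at h
  have key : (p * s) ^ 2 + PowerSeries.X * (r * q) ^ 2 = 0 := by
    apply IsFractionRing.injective (ZMod 2)⟦X⟧ PowerSeriesFractions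
    simp only [map_add, map_mul, map_pow, map_zero]
    linear_combination h
  obtain ⟨h₁, h₂⟩ := PowerSeries.eq_zero_of_sq_add_X_mul_sq key
  constructor
  · simp [(mul_eq_zero.1 h₁).resolve_right hs₀]
  · simp [(mul_eq_zero.1 h₂).resolve_right hq₀]

/-- In characteristic two, a combination of squares splits into its even and its odd part. -/
theorem smul_decomposition {k : ℕ} (c u v : Fin k → (ZMod 2)[X]) (y : Fin k → PowerSeriesFractions)
    (h : ∀ i, c i = u i ^ 2 + Polynomial.X * v i ^ 2) :
    ∑ i, c i • y i ^ 2 = (∑ i, u i • y i) ^ 2 +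
      algebraMap (ZMod 2)[X] PowerSeriesFractions Polynomial.X * (∑ i, v i • y i) ^ 2 := by
  rw [CharTwo.sum_sq, CharTwo.sum_sq, Finset.mul_sum, ← Finset.sum_add_distrib]
  refine Finset.sum_congr rfl fun i _ => ?_
  rw [h i]
  simp only [Algebra.smul_def, map_add, map_mul, map_pow]
  ring

theorem exists_frobenius_relation_of_isAlgebraic {y : PowerSeriesFractions}
    (hy : IsAlgebraic (ZMod 2)[X] y) :
    ∃ (k : ℕ) (c : Fin (k + 1) → (ZMod 2)[X]), c ≠ 0 ∧ ∑ i, c i • y ^ 2 ^ (i : ℕ) = 0 := by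
  have hli : ¬ LinearIndependent (ZMod 2)[X] fun i : ℕ => y ^ 2 ^ i := by
    let := FractionRing.liftAlgebra (ZMod 2)[X] PowerSeriesFractions
    intro hli
    rw [LinearIndependent.iff_fractionRing (ZMod 2)[X] (FractionRing (ZMod 2)[X])] at hli
    have hy' : IsIntegral (FractionRing (ZMod 2)[X]) y :=
      (hy.extendScalars (IsFractionRing.injective _ _)).isIntegral
    have := hy'.fg_adjoin_singleton
    let A := Algebra.adjoin (FractionRing (ZMod 2)[X]) {y}
    have : Module.Finite (FractionRing (ZMod 2)[X]) A := Module.Finite.iff_fg.2 this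
    let z : A := ⟨y, Algebra.subset_adjoin rfl⟩
    have : LinearIndependent (FractionRing (ZMod 2)[X]) fun i : ℕ => z ^ 2 ^ i :=
      LinearIndependent.of_comp A.val.toLinearMap hli
    exact Module.Finite.not_linearIndependent_of_infinite _ this
  obtain ⟨s, c, h, j, hj, hcj⟩ := not_linearIndependent_iff.1 hli
  have hs : s ⊆ Finset.range (s.sup id + 1) := fun i hi =>
    Finset.mem_range.2 (Nat.lt_succ_of_le (Finset.le_sup (f := id) hi))
  classical
  refine ⟨s.sup id, fun i => if (i : ℕ) ∈ s then c i else 0, fun h₀ => hcj ?_, ?_⟩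
  · simpa [hj] using congrFun h₀ ⟨j, Finset.mem_range.1 (hs hj)⟩
  · rw [Fin.sum_univ_eq_sum_range (fun i => (if i ∈ s then c i else 0) • y ^ 2 ^ i),
      ← Finset.sum_subset hs fun i _ hi => by simp [hi], ← h]
    exact Finset.sum_congr rfl fun i hi => by rw [if_pos hi]

theorem exists_frobenius_relation_head_ne_zero {y : PowerSeriesFractions} (k : ℕ)
    (c : Fin (k + 1) → (ZMod 2)[X]) (hc : c ≠ 0) (h : ∑ i, c i • y ^ 2 ^ (i : ℕ) = 0) :
    ∃ (k : ℕ) (c : Fin (k + 1) → (ZMod 2)[X]), c 0 ≠ 0 ∧ ∑ i, c i • y ^ 2 ^ (i : ℕ) = 0 := by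
  induction k with
  | zero =>
    refine ⟨0, c, fun h₀ => hc ?_, h⟩
    ext1 i
    rw [Fin.fin_one_eq_zero i, h₀]
    rfl
  | succ k ih =>
    by_cases h₀ : c 0 = 0
    · choose u v huv _ _ using fun i : Fin (k + 1) => (c i.succ).exists_eq_sq_add_X_mul_sq
      rw [Fin.sum_univ_succ, h₀, zero_smul, zero_add] at h
      simp only [Fin.val_succ, pow_succ 2, pow_mul] at h
      rw [smul_decomposition (fun i : Fin (k + 1) => c i.succ) u v
        (fun i => y ^ 2 ^ (i : ℕ)) huv] at h
      obtain ⟨hu, hv⟩ := eq_zero_of_sq_add_X_mul_sq h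
      by_cases hu₀ : u = 0
      · refine ih v (fun hv₀ => hc ?_) hv
        funext i
        refine Fin.cases h₀ (fun i => ?_) i
        rw [huv, hu₀, hv₀]
        simp
      · exact ih u hu₀ hu
    · exact ⟨_, c, h₀, h⟩

/-- An algebraic power series over the two-element field lies in a finite set of power series that
contains with every series its even and its odd part. -/
theorem exists_finite_closed_of_isAlgebraic {g : (ZMod 2)⟦X⟧} (hg : IsAlgebraic (ZMod 2)[X] g) :
    ∃ V : Set (ZMod 2)⟦X⟧, V.Finite ∧ g ∈ V ∧
      ∀ f ∈ V, ∃ u ∈ V, ∃ v ∈ V, f = u ^ 2 + PowerSeries.X * v ^ 2 := by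
  set y := algebraMap (ZMod 2)⟦X⟧ PowerSeriesFractions g with hy
  have hyalg : IsAlgebraic (ZMod 2)[X] y := hg.algebraMap
  obtain ⟨k, c, hc, hrel⟩ := exists_frobenius_relation_of_isAlgebraic hyalg
  obtain ⟨k, c, hc, hrel⟩ := exists_frobenius_relation_head_ne_zero k c hc hrel
  have hc' : algebraMap (ZMod 2)[X] PowerSeriesFractions (c 0) ≠ 0 := fun h =>
    hc (algebraMap_polynomial_injective (by simpa using h))
  set z := y / algebraMap (ZMod 2)[X] PowerSeriesFractions (c 0) with hz
  have hyz : y = algebraMap (ZMod 2)[X] PowerSeriesFractions (c 0) * z := by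
    rw [hz]
    field_simp
  let e : Fin k → (ZMod 2)[X] := fun i => c i.succ * c 0 ^ (2 ^ ((i : ℕ) + 1) - 2)
  have hrel' : z = ∑ i, e i • (z ^ 2 ^ (i : ℕ)) ^ 2 := by
    rw [Fin.sum_univ_succ, CharTwo.add_eq_zero] at hrel
    have h2 : ∀ i : Fin k, c i.succ • y ^ 2 ^ (i.succ : ℕ) =
        algebraMap (ZMod 2)[X] PowerSeriesFractions (c 0) ^ 2 *
          (e i • (z ^ 2 ^ (i : ℕ)) ^ 2) := by
      intro i
      have h2 : 2 ^ ((i : ℕ) + 1) - 2 + 2 = 2 ^ ((i : ℕ) + 1) :=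
        Nat.sub_add_cancel (Nat.le_self_pow (by omega) 2)
      simp only [e, Algebra.smul_def, map_mul, map_pow, Fin.val_succ]
      rw [← pow_mul, ← pow_succ, hyz, mul_pow, ← h2, pow_add _ _ 2]
      rw [Nat.add_sub_cancel]
      ring
    rw [Finset.sum_congr rfl fun i _ => h2 i, ← Finset.mul_sum] at hrel
    refine mul_left_cancel₀ (pow_ne_zero 2 hc') (hrel.symm.trans ?_).symm
    rw [Algebra.smul_def, hyz]
    simp
    ring
  let D := (c 0).natDegree + ∑ i, (e i).natDegree
  have he (i) : (e i).natDegree ≤ D :=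
    le_add_left (Finset.single_le_sum (f := fun i => (e i).natDegree) (by simp) (Finset.mem_univ i))
  let V : Set (ZMod 2)⟦X⟧ := {f | ∃ d : Fin (k + 1) → (ZMod 2)[X], (∀ i, (d i).natDegree ≤ D) ∧
    algebraMap (ZMod 2)⟦X⟧ PowerSeriesFractions f = ∑ i, d i • z ^ 2 ^ (i : ℕ)}
  refine ⟨V, ?_, ?_, ?_⟩
  · have hfin := (Set.Finite.pi' fun _ : Fin (k + 1) =>
      Polynomial.finite_natDegree_le (ZMod 2) D).image fun d =>
        ∑ i : Fin (k + 1), d i • z ^ 2 ^ (i : ℕ)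
    refine (hfin.preimage
      (IsFractionRing.injective (ZMod 2)⟦X⟧ PowerSeriesFractions).injOn).subset ?_
    rintro f ⟨d, hd, hf⟩
    exact ⟨d, hd, hf.symm⟩
  · refine ⟨Fin.cons (c 0) 0, fun i => ?_, ?_⟩
    · refine Fin.cases ?_ (fun i => ?_) i
      · exact Nat.le_add_right _ _
      · simp
    · rw [Fin.sum_univ_succ, ← hy, hyz, Algebra.smul_def]
      simp
  · rintro f ⟨d, hd, hf⟩
    choose u v huv hu hv using fun i : Fin k =>
      (d 0 * e i + d i.succ).exists_eq_sq_add_X_mul_sq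
    have hdeg (i : Fin k) : (d 0 * e i + d i.succ).natDegree ≤ 2 * D := by
      refine (Polynomial.natDegree_add_le _ _).trans (max_le ?_ ?_)
      · refine Polynomial.natDegree_mul_le.trans ?_
        have := hd 0
        have := he i
        omega
      · have := hd i.succ
        omega
    have key : algebraMap (ZMod 2)⟦X⟧ PowerSeriesFractions f =
        (∑ i, u i • z ^ 2 ^ (i : ℕ)) ^ 2 +
          algebraMap (ZMod 2)[X] PowerSeriesFractions Polynomial.X *
            (∑ i, v i • z ^ 2 ^ (i : ℕ)) ^ 2 := by
      rw [← smul_decomposition _ u v (fun i : Fin k => z ^ 2 ^ (i : ℕ)) huv, hf,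
        Fin.sum_univ_succ]
      simp only [add_smul, Finset.sum_add_distrib, mul_smul]
      rw [← Finset.smul_sum, ← hrel']
      simp [pow_succ, pow_mul]
    obtain ⟨p, q, hpq⟩ := f.exists_eq_sq_add_X_mul_sq
    rw [hpq, map_add, map_mul, map_pow, map_pow, ← algebraMap_polynomial_X] at key
    obtain ⟨h₁, h₂⟩ := eq_zero_of_sq_add_X_mul_sq
      (u := algebraMap _ _ p + ∑ i, u i • z ^ 2 ^ (i : ℕ))
      (v := algebraMap _ _ q + ∑ i, v i • z ^ 2 ^ (i : ℕ)) (by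
        rw [CharTwo.add_sq, CharTwo.add_sq, mul_add, add_add_add_comm, key]
        exact CharTwo.add_self_eq_zero _)
    rw [CharTwo.add_eq_zero] at h₁ h₂
    refine ⟨p, ⟨Fin.snoc u 0, fun i => ?_, ?_⟩, q, ⟨Fin.snoc v 0, fun i => ?_, ?_⟩, hpq⟩
    · refine Fin.lastCases ?_ (fun i => ?_) i
      · simp
      · have := hu i
        have := hdeg i
        rw [Fin.snoc_castSucc]
        omega
    · rw [h₁, Fin.sum_univ_castSucc]
      simp
    · refine Fin.lastCases ?_ (fun i => ?_) i
      · simp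
      · have := hv i
        have := hdeg i
        rw [Fin.snoc_castSucc]
        omega
    · rw [h₂, Fin.sum_univ_castSucc]
      simp

end Christol

/-! ### Power series in two variables as weighted languages -/

section WordSeries

/-- The weighted language in which the word `a^n b^m` has the weight given by the coefficient of
`a^n b^m` in a power series, and all other words have weight zero. -/
noncomputable def wordSeries :
    MvPowerSeries Letter (ZMod 2) →ₗ[ZMod 2] (List Letter → ZMod 2) where
  toFun g w := open Classical in
    if h : ∃ e, abWord e = w then MvPowerSeries.coeff h.choose g else 0
  map_add' f g := by
    funext w
    simp only [Pi.add_apply]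
    split_ifs <;> simp
  map_smul' c g := by
    funext w
    simp only [Pi.smul_apply, RingHom.id_apply]
    split_ifs <;> simp

theorem wordSeries_abWord (g : MvPowerSeries Letter (ZMod 2)) (e : Letter →₀ ℕ) :
    wordSeries g (abWord e) = MvPowerSeries.coeff e g := by
  classical
  have h : ∃ e', abWord e' = abWord e := ⟨e, rfl⟩
  change (if h : ∃ e', abWord e' = abWord e then MvPowerSeries.coeff h.choose g else 0) = _
  rw [dif_pos h, abWord_injective h.choose_spec]

theorem wordSeries_eq_zero (g : MvPowerSeries Letter (ZMod 2)) {w : List Letter}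
    (h : ¬ ∃ e, abWord e = w) : wordSeries g w = 0 :=
  dif_neg h

theorem exists_of_wordSeries_ne_zero {g : MvPowerSeries Letter (ZMod 2)} {w : List Letter}
    (h : wordSeries g w ≠ 0) : ∃ e, abWord e = w ∧ MvPowerSeries.coeff e g ≠ 0 := by
  by_cases hw : ∃ e, abWord e = w
  · obtain ⟨e, rfl⟩ := hw
    exact ⟨e, rfl, by rwa [wordSeries_abWord] at h⟩
  · exact absurd (wordSeries_eq_zero g hw) h

theorem setOf_wordSeries_eq_one (g : MvPowerSeries Letter (ZMod 2)) :
    ({w | wordSeries g w = 1} : Language Letter) = (Dual.symm g).1 := by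
  ext w
  change wordSeries g w = 1 ↔ ∃ e, abWord e = w ∧ MvPowerSeries.coeff e g = 1
  constructor
  · intro h
    obtain ⟨e, rfl, -⟩ := exists_of_wordSeries_ne_zero (by rw [h]; exact one_ne_zero)
    exact ⟨e, rfl, by rwa [wordSeries_abWord] at h⟩
  · rintro ⟨e, rfl, h⟩
    rwa [wordSeries_abWord]

theorem wordSeries_monomial (e : Letter →₀ ℕ) (w : List Letter) [Decidable (w = abWord e)] :
    wordSeries (MvPowerSeries.monomial e 1) w = if w = abWord e then 1 else 0 := by
  classical
  by_cases hw : ∃ e, abWord e = w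
  · obtain ⟨e', rfl⟩ := hw
    rw [wordSeries_abWord, MvPowerSeries.coeff_monomial]
    simp only [abWord_injective.eq_iff]
  · rw [wordSeries_eq_zero _ hw, if_neg]
    rintro rfl
    exact hw ⟨e, rfl⟩

theorem abWord_zero : abWord 0 = [] := rfl

theorem abWord_single (x : Letter) : abWord (Finsupp.single x 1) = [x] := by
  cases x <;> simp [abWord]

theorem abWord_append {e e' : Letter →₀ ℕ} (h : e .b = 0 ∨ e' .a = 0) :
    abWord e ++ abWord e' = abWord (e + e') := by
  rcases h with h | h
  · simp only [abWord, h, Finsupp.add_apply, List.replicate_add, List.replicate_zero,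
      List.append_nil, zero_add, List.append_assoc]
  · simp only [abWord, h, Finsupp.add_apply, List.replicate_add, List.replicate_zero,
      List.nil_append, add_zero, List.append_assoc]

theorem wordConv_wordSeries {g h : MvPowerSeries Letter (ZMod 2)}
    (hgh : ∀ e e', MvPowerSeries.coeff e g ≠ 0 → MvPowerSeries.coeff e' h ≠ 0 →
      e .b = 0 ∨ e' .a = 0) :
    wordConv (wordSeries g) (wordSeries h) = wordSeries (g * h) := by
  classical
  funext w
  have split {p : List Letter × List Letter} (hp : wordSeries g p.1 * wordSeries h p.2 ≠ 0) :
      ∃ e e', MvPowerSeries.coeff e g ≠ 0 ∧ MvPowerSeries.coeff e' h ≠ 0 ∧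
        (abWord e, abWord e') = p ∧ p.1 ++ p.2 = abWord (e + e') := by
    obtain ⟨e, he, hge⟩ := exists_of_wordSeries_ne_zero (left_ne_zero_of_mul hp)
    obtain ⟨e', he', hhe⟩ := exists_of_wordSeries_ne_zero (right_ne_zero_of_mul hp)
    exact ⟨e, e', hge, hhe, Prod.ext he he', by
      rw [← he, ← he', abWord_append (hgh e e' hge hhe)]⟩
  by_cases hw : ∃ e, abWord e = w
  · obtain ⟨e, rfl⟩ := hw
    rw [wordSeries_abWord, MvPowerSeries.coeff_mul, wordConv]
    symm
    refine Finset.sum_bij_ne_zero (fun d _ _ => (abWord d.1, abWord d.2)) ?_ ?_ ?_ ?_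
    · intro d hd hne
      rw [mem_wordAntidiagonal, abWord_append
        (hgh _ _ (left_ne_zero_of_mul hne) (right_ne_zero_of_mul hne)),
        Finset.HasAntidiagonal.mem_antidiagonal.1 hd]
    · intro d _ _ d' _ _ heq
      rw [Prod.mk.injEq] at heq
      exact Prod.ext (abWord_injective heq.1) (abWord_injective heq.2)
    · intro p hp hne
      obtain ⟨d, d', hd, hd', rfl, hdd⟩ := split hne
      rw [mem_wordAntidiagonal.1 hp] at hdd
      exact ⟨(d, d'), Finset.HasAntidiagonal.mem_antidiagonal.2 (abWord_injective hdd).symm, mul_ne_zero hd hd',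
        rfl⟩
    · intro d _ _
      rw [wordSeries_abWord, wordSeries_abWord]
  · rw [wordSeries_eq_zero _ hw]
    refine Finset.sum_eq_zero fun p hp => ?_
    by_contra hne
    obtain ⟨d, d', -, -, -, hdd⟩ := split hne
    exact hw ⟨_, hdd.symm.trans (mem_wordAntidiagonal.1 hp)⟩

/-- No variable except `x` occurs in the power series. -/
def OnlyIn (x : Letter) (g : MvPowerSeries Letter (ZMod 2)) : Prop :=
  ∀ e, MvPowerSeries.coeff e g ≠ 0 → ∀ y ≠ x, e y = 0

theorem OnlyIn.mul {x : Letter} {g h : MvPowerSeries Letter (ZMod 2)} (hg : OnlyIn x g)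
    (hh : OnlyIn x h) : OnlyIn x (g * h) := by
  classical
  intro e he y hy
  rw [MvPowerSeries.coeff_mul] at he
  obtain ⟨d, hd, hne⟩ := Finset.exists_ne_zero_of_sum_ne_zero he
  rw [← Finset.HasAntidiagonal.mem_antidiagonal.1 hd, Finsupp.add_apply, hg _ (left_ne_zero_of_mul hne) y hy,
    hh _ (right_ne_zero_of_mul hne) y hy]

theorem onlyIn_one (x : Letter) : OnlyIn x 1 := by
  classical
  intro e he y _
  rw [MvPowerSeries.coeff_one] at he
  rw [of_not_not fun h => he (if_neg h)]
  rfl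

theorem onlyIn_X (x : Letter) : OnlyIn x (MvPowerSeries.X x) := by
  classical
  intro e he y hy
  rw [MvPowerSeries.coeff_X] at he
  rw [of_not_not fun h => he (if_neg h), Finsupp.single_eq_of_ne hy]

theorem onlyIn_subst (x : Letter) (f : PowerSeries (ZMod 2)) :
    OnlyIn x (PowerSeries.subst (MvPowerSeries.X x : MvPowerSeries Letter (ZMod 2)) f) := by
  classical
  intro e he y hy
  rw [PowerSeries.coeff_subst (PowerSeries.HasSubst.X x)] at he
  obtain ⟨d, hd⟩ := not_forall.1 fun h => he (finsum_eq_zero_of_forall_eq_zero h)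
  have h := right_ne_zero_of_smul hd
  rw [MvPowerSeries.coeff_X_pow] at h
  rw [of_not_not fun h' => h (if_neg h'), Finsupp.single_eq_of_ne hy]

variable {N : Type} (Φ : N → MvPowerSeries Letter (ZMod 2))

/-- The power series of a symbol, given those of the nonterminals. -/
noncomputable def symbolSeries : Symbol Letter N → MvPowerSeries Letter (ZMod 2)
  | .terminal x => MvPowerSeries.X x
  | .nonterminal A => Φ A

theorem symbolLanguage_wordSeries (X : Symbol Letter N) :
    symbolLanguage (fun A => wordSeries (Φ A)) X = wordSeries (symbolSeries Φ X) := by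
  cases X with
  | nonterminal A => rfl
  | terminal x =>
    classical
    funext w
    rw [symbolSeries, MvPowerSeries.X, wordSeries_monomial]
    simp only [symbolLanguage, abWord_single]
    congr

variable {Φ}

theorem onlyIn_list_prod {x : Letter} {α : List (Symbol Letter N)}
    (h : ∀ X ∈ α, OnlyIn x (symbolSeries Φ X)) : OnlyIn x (α.map (symbolSeries Φ)).prod := by
  induction α with
  | nil => exact onlyIn_one x
  | cons X α ih =>
    rw [List.map_cons, List.prod_cons]
    exact (h X (by simp)).mul (ih fun Y hY => h Y (by simp [hY]))

theorem stringLanguage_wordSeries_of_b {β : List (Symbol Letter N)}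
    (h : ∀ X ∈ β, OnlyIn .b (symbolSeries Φ X)) :
    stringLanguage (fun A => wordSeries (Φ A)) β =
      wordSeries (β.map (symbolSeries Φ)).prod := by
  induction β with
  | nil =>
    classical
    funext w
    rw [List.map_nil, List.prod_nil, ← MvPowerSeries.monomial_zero_one, wordSeries_monomial]
    simp only [stringLanguage, abWord_zero]
    congr
  | cons X β ih =>
    have hβ : ∀ Y ∈ β, OnlyIn .b (symbolSeries Φ Y) := fun Y hY => h Y (by simp [hY])
    rw [stringLanguage, ih hβ, symbolLanguage_wordSeries, List.map_cons, List.prod_cons]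
    exact wordConv_wordSeries fun e e' _ he' => .inr (onlyIn_list_prod hβ e' he' _ (by decide))

theorem stringLanguage_wordSeries {α β : List (Symbol Letter N)} (Z : Symbol Letter N)
    (hα : ∀ X ∈ α, OnlyIn .a (symbolSeries Φ X)) (hβ : ∀ X ∈ β, OnlyIn .b (symbolSeries Φ X)) :
    stringLanguage (fun A => wordSeries (Φ A)) (α ++ Z :: β) =
      wordSeries ((α ++ Z :: β).map (symbolSeries Φ)).prod := by
  induction α with
  | nil =>
    rw [List.nil_append, stringLanguage, stringLanguage_wordSeries_of_b hβ,
      symbolLanguage_wordSeries, List.map_cons, List.prod_cons]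
    exact wordConv_wordSeries fun e e' _ he' => .inr (onlyIn_list_prod hβ e' he' _ (by decide))
  | cons X α ih =>
    rw [List.cons_append, stringLanguage, ih fun Y hY => hα Y (by simp [hY]),
      symbolLanguage_wordSeries, List.map_cons, List.prod_cons]
    exact wordConv_wordSeries fun e e' he _ => .inl (hα X (by simp) e he _ (by decide))

theorem stringLanguage_wordSeries_of_onlyIn {x : Letter} {α : List (Symbol Letter N)}
    (h : ∀ X ∈ α, OnlyIn x (symbolSeries Φ X)) :
    stringLanguage (fun A => wordSeries (Φ A)) α = wordSeries (α.map (symbolSeries Φ)).prod := by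
  cases x with
  | b => exact stringLanguage_wordSeries_of_b h
  | a =>
    rcases List.eq_nil_or_concat' α with rfl | ⟨α, Z, rfl⟩
    · exact stringLanguage_wordSeries_of_b (by simp)
    · exact stringLanguage_wordSeries Z (fun X hX => h X (by simp [hX])) (by simp)

end WordSeries

/-! ### The grammar -/

section Assembly

open scoped PowerSeries Polynomial

/-- A power series in one variable without its constant term, as a power series in the variable
`x`. -/
noncomputable def properPart (x : Letter) (f : (ZMod 2)⟦X⟧) : MvPowerSeries Letter (ZMod 2) :=
  PowerSeries.subst (MvPowerSeries.X x : MvPowerSeries Letter (ZMod 2))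
    (f - PowerSeries.C (PowerSeries.constantCoeff f))

theorem onlyIn_properPart (x : Letter) (f : (ZMod 2)⟦X⟧) : OnlyIn x (properPart x f) :=
  onlyIn_subst x _

theorem subst_eq_properPart_add (x : Letter) (f : (ZMod 2)⟦X⟧) :
    PowerSeries.subst (MvPowerSeries.X x : MvPowerSeries Letter (ZMod 2)) f =
      properPart x f + MvPowerSeries.C (PowerSeries.constantCoeff f) := by
  have hx : PowerSeries.HasSubst (MvPowerSeries.X x : MvPowerSeries Letter (ZMod 2)) :=
    PowerSeries.HasSubst.X x
  rw [properPart, ← PowerSeries.coe_substAlgHom hx, map_sub]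
  have : PowerSeries.substAlgHom hx (PowerSeries.C (PowerSeries.constantCoeff f)) =
      MvPowerSeries.C (PowerSeries.constantCoeff f) :=
    (PowerSeries.substAlgHom hx).commutes _
  rw [this, sub_add_cancel]

theorem constantCoeff_properPart (x : Letter) (f : (ZMod 2)⟦X⟧) :
    MvPowerSeries.constantCoeff (properPart x f) = 0 := by
  have hx : PowerSeries.HasSubst (MvPowerSeries.X x : MvPowerSeries Letter (ZMod 2)) :=
    PowerSeries.HasSubst.X x
  rw [properPart, PowerSeries.constantCoeff_subst hx]
  refine finsum_eq_zero_of_forall_eq_zero fun d => ?_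
  rcases d with _ | d
  · simp
  · simp

theorem properPart_sq_add_X_mul_sq (x : Letter) (u v : (ZMod 2)⟦X⟧) :
    properPart x (u ^ 2 + PowerSeries.X * v ^ 2) =
      properPart x u * properPart x u +
        MvPowerSeries.X x * (properPart x v * properPart x v) +
        MvPowerSeries.C (PowerSeries.constantCoeff v) * MvPowerSeries.X x := by
  have hx : PowerSeries.HasSubst (MvPowerSeries.X x : MvPowerSeries Letter (ZMod 2)) :=
    PowerSeries.HasSubst.X x
  have hsq (c : ZMod 2) : c ^ 2 = c := by
    revert c
    decide
  have h := subst_eq_properPart_add x (u ^ 2 + PowerSeries.X * v ^ 2)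
  rw [← PowerSeries.coe_substAlgHom hx, map_add, map_mul, map_pow, map_pow,
    PowerSeries.substAlgHom_X, PowerSeries.coe_substAlgHom hx, subst_eq_properPart_add,
    subst_eq_properPart_add] at h
  have : CharP (MvPowerSeries Letter (ZMod 2)) 2 :=
    charP_of_injective_algebraMap (algebraMap (ZMod 2) _).injective 2
  rw [CharTwo.add_sq, CharTwo.add_sq, ← map_pow MvPowerSeries.C,
    ← map_pow MvPowerSeries.C, hsq, hsq] at h
  simp only [map_add, map_mul, map_pow, hsq, PowerSeries.constantCoeff_X, zero_mul,
    add_zero] at h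
  linear_combination -h

theorem exists_finite_closed_of_family {ι : Type*} [Finite ι] (g : ι → (ZMod 2)⟦X⟧)
    (hg : ∀ i, IsAlgebraic (ZMod 2)[X] (g i)) :
    ∃ V : Set (ZMod 2)⟦X⟧, V.Finite ∧ (∀ i, g i ∈ V) ∧
      ∀ f ∈ V, ∃ u ∈ V, ∃ v ∈ V, f = u ^ 2 + PowerSeries.X * v ^ 2 := by
  choose V hfin hmem hV using fun i => exists_finite_closed_of_isAlgebraic (hg i)
  refine ⟨⋃ i, V i, Set.finite_iUnion hfin, fun i => Set.mem_iUnion.2 ⟨i, hmem i⟩, ?_⟩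
  intro f hf
  obtain ⟨i, hi⟩ := Set.mem_iUnion.1 hf
  obtain ⟨u, hu, v, hv, h⟩ := hV i f hi
  exact ⟨u, Set.mem_iUnion.2 ⟨i, hu⟩, v, Set.mem_iUnion.2 ⟨i, hv⟩, h⟩

theorem MvPolynomial.coe_mul_eq_sum (q : MvPolynomial Letter (ZMod 2))
    (g : MvPowerSeries Letter (ZMod 2)) :
    (q : MvPowerSeries Letter (ZMod 2)) * g = ∑ e ∈ q.support, MvPolynomial.coeff e q •
      (MvPowerSeries.X .a ^ e .a * (g * MvPowerSeries.X .b ^ e .b)) := by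
  have key (e : Letter →₀ ℕ) (c : ZMod 2) : ((MvPolynomial.monomial e c :
      MvPolynomial Letter (ZMod 2)) : MvPowerSeries Letter (ZMod 2)) =
      c • (MvPowerSeries.X .a ^ e .a * MvPowerSeries.X .b ^ e .b) := by
    have he : e = Finsupp.single .a (e .a) + Finsupp.single .b (e .b) := by
      ext x
      cases x <;> simp
    rw [MvPolynomial.coe_monomial, MvPowerSeries.X_pow_eq, MvPowerSeries.X_pow_eq,
      MvPowerSeries.monomial_mul_monomial, ← he, ← map_smul]
    simp
  have hq : (q : MvPowerSeries Letter (ZMod 2)) = ∑ e ∈ q.support, MvPolynomial.coeff e q •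
      (MvPowerSeries.X .a ^ e .a * MvPowerSeries.X .b ^ e .b) := by
    conv_lhs => rw [q.as_sum]
    rw [← MvPolynomial.coeToMvPowerSeries.ringHom_apply, map_sum]
    exact Finset.sum_congr rfl fun e _ => key _ _
  conv_lhs => rw [hq]
  rw [Finset.sum_mul]
  refine Finset.sum_congr rfl fun e _ => ?_
  rw [smul_mul_assoc]
  congr 1
  ring

theorem isDescribedByGF2Grammar_dual_symm {n : ℕ} (A B : Fin n → (ZMod 2)⟦X⟧)
    (hA : ∀ i, IsAlgebraic (ZMod 2)[X] (A i)) (hB : ∀ i, IsAlgebraic (ZMod 2)[X] (B i))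
    (q : MvPolynomial Letter (ZMod 2)) (hq : MvPolynomial.constantCoeff q = 0)
    (g : MvPowerSeries Letter (ZMod 2))
    (hg : g = ∑ i, PowerSeries.subst (MvPowerSeries.X .a : MvPowerSeries Letter (ZMod 2)) (A i) *
      PowerSeries.subst (MvPowerSeries.X .b : MvPowerSeries Letter (ZMod 2)) (B i) + q * g) :
    IsDescribedByGF2Grammar (Dual.symm g : Language Letter) := by
  obtain ⟨V, hfin, hmem, hV⟩ := exists_finite_closed_of_family (Sum.elim A B)
    (Sum.rec hA hB)
  have : Finite V := hfin
  have : Finite Letter := Finite.of_injective (fun x => decide (x = .a)) fun x y => by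
    cases x <;> cases y <;> decide
  choose u hu v hv huv using hV
  let N := Option (Letter × V)
  have : Finite N := inferInstanceAs (Finite (Option (Letter × V)))
  let nt (x : Letter) (f : V) : Symbol Letter N := .nonterminal (some (x, f))
  let α (i) : Symbol Letter N := nt .a ⟨A i, hmem (.inl i)⟩
  let β (i) : Symbol Letter N := nt .b ⟨B i, hmem (.inr i)⟩
  let rhs : N → List (Symbol Letter N) →₀ ZMod 2
    | some (x, f) =>
      Finsupp.single [nt x ⟨_, hu f.1 f.2⟩, nt x ⟨_, hu f.1 f.2⟩] 1 +
        Finsupp.single [.terminal x, nt x ⟨_, hv f.1 f.2⟩, nt x ⟨_, hv f.1 f.2⟩] 1 +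
        Finsupp.single [.terminal x] (PowerSeries.constantCoeff (v f.1 f.2))
    | none =>
      ∑ i, (Finsupp.single [α i, β i] 1 +
        Finsupp.single [α i] (PowerSeries.constantCoeff (B i)) +
        Finsupp.single [β i] (PowerSeries.constantCoeff (A i)) +
        Finsupp.single [] (PowerSeries.constantCoeff (A i) * PowerSeries.constantCoeff (B i))) +
      ∑ e ∈ q.support, Finsupp.single (List.replicate (e .a) (.terminal .a) ++
        .nonterminal none :: List.replicate (e .b) (.terminal .b)) (MvPolynomial.coeff e q)
  let wt : N → ℤ := fun X => X.elim 1 fun _ => -1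
  let Φ : N → MvPowerSeries Letter (ZMod 2) := fun X => X.elim g fun p => properPart p.1 p.2.1
  have hnt (x f) : OnlyIn x (symbolSeries Φ (nt x f)) := onlyIn_properPart x f.1
  have ht (x) : OnlyIn x (symbolSeries Φ (.terminal x)) := onlyIn_X x
  rw [← setOf_wordSeries_eq_one]
  refine isDescribedByGF2Grammar_of_solution (N := N) none (C := 2) (wt := wt) rhs ?_
    (fun X => wordSeries (Φ X)) ?_ ?_
  · intro X
    suffices rhs X ∈ Finsupp.supported (ZMod 2) (ZMod 2)
        {γ : List (Symbol Letter N) | 1 + stringWeight 2 wt γ ≤ wt X} from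
      fun γ hγ => (Finsupp.mem_supported _ _).1 this hγ
    rcases X with _ | ⟨x, f⟩
    · refine add_mem (sum_mem fun i _ => add_mem (add_mem (add_mem ?_ ?_) ?_) ?_)
        (sum_mem fun e he => ?_) <;> refine Finsupp.single_mem_supported _ _ ?_
      · simp [stringWeight, symbolWeight, wt, α, β, nt]
      · simp [stringWeight, symbolWeight, wt, α, nt]
      · simp [stringWeight, symbolWeight, wt, β, nt]
      · simp [stringWeight, wt]
      · have he₀ : e .a + e .b ≠ 0 := by
          intro h
          have : e = 0 := by
            ext x
            cases x <;> simp <;> omega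
          rw [MvPolynomial.mem_support_iff, this] at he
          exact he hq
        simp only [stringWeight, symbolWeight, wt, Set.mem_ofPred_eq, List.map_append,
          List.map_cons, List.map_replicate, List.sum_append, List.sum_cons, List.sum_replicate,
          Option.elim_none, nsmul_eq_mul]
        push_cast
        omega
    · refine add_mem (add_mem ?_ ?_) ?_ <;> refine Finsupp.single_mem_supported _ _ ?_
      · simp [stringWeight, symbolWeight, wt, nt]
      · simp [stringWeight, symbolWeight, wt, nt]
      · simp [stringWeight, symbolWeight, wt]
  · rintro (_ | ⟨x, f⟩) w hw
    · simp only [wt, Option.elim_none] at hw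
      omega
    · simp only [wt, Option.elim_some] at hw
      rw [List.eq_nil_of_length_eq_zero (l := w) (by omega), ← abWord_zero, wordSeries_abWord]
      exact constantCoeff_properPart x f.1
  · rintro (_ | ⟨x, f⟩)
    · simp only [rhs, map_add, map_sum, Finsupp.linearCombination_single]
      have h₁ (i) := stringLanguage_wordSeries (Φ := Φ) (α := [α i]) (β := []) (β i)
        (by simpa [α] using hnt _ _) (by simp)
      have h₂ (i) := stringLanguage_wordSeries (Φ := Φ) (α := []) (β := []) (α i)
        (by simp) (by simp)
      have h₃ (i) := stringLanguage_wordSeries (Φ := Φ) (α := []) (β := []) (β i)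
        (by simp) (by simp)
      have h₄ := stringLanguage_wordSeries_of_b (Φ := Φ) (β := []) (by simp)
      have h₅ (e : Letter →₀ ℕ) := stringLanguage_wordSeries (Φ := Φ)
        (α := List.replicate (e .a) (.terminal .a)) (β := List.replicate (e .b) (.terminal .b))
        (.nonterminal none)
        (fun X hX => by rw [List.eq_of_mem_replicate hX]; exact ht _)
        (fun X hX => by rw [List.eq_of_mem_replicate hX]; exact ht _)
      simp only [List.nil_append, List.singleton_append] at h₁ h₂ h₃
      simp only [h₁, h₂, h₃, h₄, h₅, ← map_smul, ← map_add, ← map_sum]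
      congr 1
      change g = _
      conv_lhs => rw [hg]
      rw [MvPolynomial.coe_mul_eq_sum]
      congr 1
      · refine Finset.sum_congr rfl fun i _ => ?_
        rw [subst_eq_properPart_add, subst_eq_properPart_add]
        simp [symbolSeries, α, β, nt, Φ, MvPowerSeries.smul_eq_C_mul]
        ring
      · refine Finset.sum_congr rfl fun e _ => ?_
        simp [symbolSeries, Φ]
    · simp only [rhs, map_add, Finsupp.linearCombination_single]
      rw [stringLanguage_wordSeries_of_onlyIn (x := x) (by simpa using hnt _ _),
        stringLanguage_wordSeries_of_onlyIn (x := x) (by simpa using ⟨ht x, hnt _ _⟩),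
        stringLanguage_wordSeries_of_onlyIn (x := x) (by simpa using ht x)]
      simp only [← map_smul, ← map_add]
      congr 1
      change properPart x f.1 = _
      conv_lhs => rw [huv f.1 f.2]
      rw [properPart_sq_add_X_mul_sq]
      simp [symbolSeries, nt, Φ, MvPowerSeries.smul_eq_C_mul]

end Assembly

theorem theorem5p1 (f : ABLaurentSeries) (hf : f ∈ Rint) :
    ∃ g : MvPowerSeries Letter (ZMod 2),
      algebraMap (MvPowerSeries Letter (ZMod 2)) ABLaurentSeries g = f ∧
      IsDescribedByGF2Grammar (Dual.symm g : Language Letter) := by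
  obtain ⟨n, A, B, p, hA, hB, hp, rfl⟩ := hf
  choose A' hA' hAA' using hA
  choose B' hB' hBB' using hB
  have hp' : MvPowerSeries.constantCoeff (p : MvPowerSeries Letter (ZMod 2)) ≠ 0 := by
    rw [← MvPowerSeries.coeff_zero_eq_constantCoeff_apply, MvPolynomial.coeff_coe]
    change MvPolynomial.constantCoeff p ≠ 0
    simp [hp]
  have hp₀ : algebraMap (MvPowerSeries Letter (ZMod 2)) ABLaurentSeries
      (p : MvPowerSeries Letter (ZMod 2)) ≠ 0 := by
    intro h
    rw [IsFractionRing.injective (MvPowerSeries Letter (ZMod 2)) ABLaurentSeries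
      (h.trans (map_zero _).symm)] at hp'
    simp at hp'
  have hg := MvPowerSeries.mul_inv_cancel _ hp'
  refine ⟨(∑ i, A i * B i) * (p : MvPowerSeries Letter (ZMod 2))⁻¹, ?_, ?_⟩
  · rw [eq_div_iff hp₀, ← map_mul, mul_assoc, mul_comm _⁻¹, hg, mul_one]
  · refine isDescribedByGF2Grammar_dual_symm A' B' hA' hB' (1 - p) (by simp [hp]) _ ?_
    have h1 : ((1 - p : MvPolynomial Letter (ZMod 2)) : MvPowerSeries Letter (ZMod 2)) = 1 - p := by
      simpa using map_sub MvPolynomial.coeToMvPowerSeries.ringHom 1 p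
    simp only [← hAA', ← hBB']
    rw [h1]
    linear_combination (∑ i, A i * B i) * hg
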